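/- Let $(X,d_X)$ be a compact metric space and let $\mathcal P(X)$ be the set of Borel probability measures on $X$ with the topology of weak convergence and the Kantorovich–Rubinstein distance $d_{KR}(\mu_1,\mu_2)=\sup\{\int\phi\,d\mu_1-\int\phi\,d\mu_2 : \phi:X\to\mathbb R \text{ 1-Lipschitz}\}$. For $M\ge 1$ and $\vec x\in X^M$ write $\hat\mu[\vec x]=\frac1M\sum_{i=1}^M\delta_{x_i}$. A kernel on a set $S$ is a function $k:S\times S\to\mathbb R$ of the form $k(s,s')=\langle\Phi(s'),\Phi(s)\rangle_{\mathcal H}$ with a map $\Phi$ from $S$ to a real Hilbert space $\mathcal H$; $H_k$ denotes its reproducing kernel Hilbert space. For each $M\ge 1$ let $k^{[M]}$ be a kernel on $X^M$, with RKHS $H_M:=H_{k^{[M]}}$, such that 1. $k^{[M]}(\sigma\vec x,\vec x')=k^{[M]}(\vec x,\vec x')$ for all $M\ge1$, all $\vec x,\vec x'\in X^M$ and all permutations $\sigma$ of $\{1,\dots,M\}$, where $\sigma\vec x=(x_{\sigma(1)},\dots,x_{\sigma(M)})$; 2. there is $C_k\ge 0$ with $|k^{[M]}(\vec x,\vec x')|\le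 C_k$ for all $M\ge1$ and $\vec x,\vec x'\in X^M$; 3. there is a continuous nondecreasing $\omega_k:[0,\infty)\to[0,\infty)$ with $\omega_k(0)=0$ such that for all $M\ge1$ and $\vec x_1,\vec x_1',\vec x_2,\vec x_2'\in X^M$, $$|k^{[M]}(\vec x_1,\vec x_1')-k^{[M]}(\vec x_2,\vec x_2')|\le\omega_k\big(d_{KR}(\hat\mu[\vec x_1],\hat\mu[\vec x_2])+d_{KR}(\hat\mu[\vec x_1'],\hat\mu[\vec x_2'])\big).$$ Let $k$ be a mean field limit of these kernels, that is, a continuous bounded kernel on $\mathcal P(X)$ for which there is a strictly increasing sequence $(M_\ell)_\ell$ of positive integers, fixed from now on, with $$\lim_{\ell\to\infty}\sup_{\vec x,\vec x'\in X^{M_\ell}}\big|k^{[M_\ell]}(\vec x,\vec x')-k(\hat\mu[\vec x],\hat\mu[\vec x'])\big|=0 .$$ Then for every $f\in H_k$ there are a subsequence $(M^{(2)}_\ell)_\ell$ of $(M_\ell)_\ell$ and functions $f_{M^{(2)}_\ell}\in H_{M^{(2)}_\ell}$ such that $$\lim_{\ell\to\infty}\ \sup_{\vec x\in X^{M^{(2)}_\ell}}\big|f_{M^{(2)}_\ell}(\vec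 x)-f(\hat\mu[\vec x])\big|=0 .$$ -/

import Mathlib

open MeasureTheory Filter Topology
open scoped ENNReal

universe u

namespace MeanField

/-- A (real) kernel on `S`: a function `k : S × S → ℝ` for which there are a real Hilbert space `H`
and a feature map `Φ : S → H` with `k x x' = ⟪Φ x', Φ x⟫`. -/
structure RealKernel (S : Type u) where
  toFun : S → S → ℝ
  exists_featureMap : ∃ (H : Type u) (_ : NormedAddCommGroup H) (_ : InnerProductSpace ℝ H)
    (_ : CompleteSpace H) (Φ : S → H), ∀ x x', toFun x x' = inner ℝ (Φ x') (Φ x)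

instance {S : Type u} : CoeFun (RealKernel S) (fun _ => S → S → ℝ) := ⟨RealKernel.toFun⟩

/-- The kernel as a matrix with entries in `ℝ →L[ℝ] ℝ`, the form used by Mathlib's `RKHS`:
the entry at `(x, y)` is multiplication by `k x y`. -/
noncomputable def RealKernel.matrix {S : Type u} (k : RealKernel S) : Matrix S S (ℝ →L[ℝ] ℝ) :=
  Matrix.of fun x y => k x y • ContinuousLinearMap.id ℝ ℝ

theorem RealKernel.matrix_apply {S : Type u} (k : RealKernel S) (x y : S) :
    k.matrix x y = k x y • ContinuousLinearMap.id ℝ ℝ := rfl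

theorem RealKernel.matrix_posSemidef {S : Type u} (k : RealKernel S) : k.matrix.PosSemidef := by
  obtain ⟨H, _, _, _, Φ, hΦ⟩ := k.exists_featureMap
  have htfae := (RKHS.posSemidef_tfae (K := k.matrix)).out 0 2
  refine htfae.mpr ⟨?_, fun v => ?_⟩
  · ext x y
    have hid : star (ContinuousLinearMap.id ℝ ℝ) = ContinuousLinearMap.id ℝ ℝ := star_one _
    rw [Matrix.conjTranspose_apply, matrix_apply, matrix_apply, star_smul, hid, hΦ, hΦ,
      real_inner_comm]
    rfl
  · have h : (v.sum fun x w => v.sum fun x' w' => inner ℝ (k.matrix x' x w) w')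
        = inner ℝ (v.sum fun x w => w • Φ x) (v.sum fun x w => w • Φ x) := by
      rw [Finsupp.sum_inner]
      refine Finsupp.sum_congr fun x _ => ?_
      rw [Finsupp.inner_sum]
      refine Finsupp.sum_congr fun x' _ => ?_
      simp [matrix_apply, hΦ, inner_smul_left, inner_smul_right]
      left
      ring
    rw [h]
    exact real_inner_self_nonneg

instance {S : Type u} (k : RealKernel S) : Fact k.matrix.PosSemidef := ⟨k.matrix_posSemidef⟩

/-- The reproducing kernel Hilbert space `H_k` of the kernel `k`. Its elements coerce
(injectively) to functions `S → ℝ`. -/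
noncomputable abbrev RealKernel.rkhs {S : Type u} (k : RealKernel S) : Type u :=
  RKHS.OfKernel k.matrix

variable {X : Type u} [MetricSpace X] [MeasurableSpace X] [BorelSpace X]

/-- The Kantorovich–Rubinstein distance
`sup { ∫ φ dμ₁ - ∫ φ dμ₂ | φ : X → ℝ is 1-Lipschitz }` (used for compact `X`). -/
noncomputable def dKR (μ₁ μ₂ : ProbabilityMeasure X) : ℝ :=
  sSup {r : ℝ | ∃ φ : X → ℝ, LipschitzWith 1 φ ∧
    r = ∫ x, φ x ∂(μ₁ : Measure X) - ∫ x, φ x ∂(μ₂ : Measure X)}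

/-- The distance `dKR μ₁ μ₂ + dKR μ₁' μ₂'` on pairs of probability measures. -/
noncomputable def dKR2 (p q : ProbabilityMeasure X × ProbabilityMeasure X) : ℝ :=
  dKR p.1 q.1 + dKR p.2 q.2

/-- The empirical measure `(1 / M) ∑ i, δ_{x i}` of a tuple of `M ≥ 1` points. -/
noncomputable def empirical {M : ℕ+} (x : Fin M → X) : ProbabilityMeasure X :=
  ⟨((M : ℕ) : ℝ≥0∞)⁻¹ • ∑ i, Measure.dirac (x i), ⟨by
    simp [ENNReal.inv_mul_cancel]⟩⟩

/-- A modulus of continuity: a continuous, nondecreasing function `ω` on `[0, ∞)` with `ω 0 = 0`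
(hence with nonnegative values). Values at negative arguments are irrelevant. -/
structure IsModulus (ω : ℝ → ℝ) : Prop where
  continuousOn : ContinuousOn ω (Set.Ici 0)
  monotoneOn : MonotoneOn ω (Set.Ici 0)
  map_zero : ω 0 = 0

/-- The conditions on the sequence of kernels `k M` on `X ^ M`, `M ≥ 1`. -/
structure MeanFieldConditions (k : (M : ℕ+) → RealKernel (Fin M → X)) : Prop where
  symmetric : ∀ (M : ℕ+) (σ : Equiv.Perm (Fin M)) (x x' : Fin M → X), k M (x ∘ σ) x' = k M x x'
  bounded : ∃ C : ℝ, 0 ≤ C ∧ ∀ (M : ℕ+) (x x' : Fin M → X), |k M x x'| ≤ C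
  uniformContinuous : ∃ ω : ℝ → ℝ, IsModulus ω ∧
    ∀ (M : ℕ+) (x₁ x₁' x₂ x₂' : Fin M → X), |k M x₁ x₁' - k M x₂ x₂'| ≤
      ω (dKR2 (empirical x₁, empirical x₁') (empirical x₂, empirical x₂'))

/-- The continuous, bounded kernel `κ` on the space of probability measures (with the topology of
weak convergence) is the mean field limit of the kernels `k M` along the subsequence `m`.
The supremum is taken in `[0, ∞]`. -/
structure IsMeanFieldLimit (k : (M : ℕ+) → RealKernel (Fin M → X)) (m : ℕ → ℕ+)
    (κ : RealKernel (ProbabilityMeasure X)) : Prop where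
  strictMono : StrictMono m
  continuous : Continuous fun p : ProbabilityMeasure X × ProbabilityMeasure X => κ p.1 p.2
  bounded : ∃ C : ℝ, ∀ μ μ' : ProbabilityMeasure X, |κ μ μ'| ≤ C
  tendsto : Tendsto (fun l => ⨆ (x : Fin (m l) → X) (x' : Fin (m l) → X),
    ENNReal.ofReal |k (m l) x x' - κ (empirical x) (empirical x')|) atTop (𝓝 0)

end MeanField

/-!
The functions `f` on probability measures for which `f ∘ empirical` is, for all large `l`, uniformly
close to an element of the RKHS of `k (m l)` (`IsApproximable`) are stable under linear combinations
and uniform limits. Since `κ` is bounded, norm convergence in its RKHS is uniform convergence, and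
the kernel functions `κ(·, μ)` span a dense subspace; so it is enough to approximate those.

If `μ` is itself the limit of empirical measures of tuples `y l` of size `m l`, then
`k (m l) (·, y l)` does this: it is uniformly close to `κ(·, empirical (y l))` by the definition of
the mean field limit, and `κ(·, empirical (y l))` tends to `κ(·, μ)` in the RKHS, hence uniformly,
because `‖κ(·, ν) - κ(·, μ)‖² = κ(ν, ν) - 2 κ(ν, μ) + κ(μ, μ)`
(`RealKernel.continuous_kerFun`). Such tuples exist by the strong law of large numbers: almost every
i.i.d. sample of `μ` has empirical measures converging weakly to `μ`
(`exists_tendsto_empirical`).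
-/

namespace MeanField

/-! ### The reproducing kernel Hilbert space of a real kernel -/

namespace RealKernel

variable {S : Type u} (k : RealKernel S)

theorem comm (s t : S) : k s t = k t s := by
  obtain ⟨H, _, _, _, Φ, hΦ⟩ := k.exists_featureMap
  rw [hΦ, hΦ, real_inner_comm]

theorem kerFun_apply (s t : S) (v : ℝ) : RKHS.kerFun k.rkhs t v s = k s t * v := by
  rw [RKHS.kerFun_apply, RKHS.OfKernel.kernel_ofKernel, matrix_apply]
  rfl

theorem inner_kerFun_kerFun (s t : S) (v w : ℝ) :
    inner ℝ (RKHS.kerFun k.rkhs s v) (RKHS.kerFun k.rkhs t w) = k s t * (v * w) := by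
  rw [RKHS.inner_kerFun, kerFun_apply, k.comm]
  simp only [RCLike.inner_apply, conj_trivial]
  ring

/-- A diagonal bound on the kernel bounds point evaluations by the norm of the RKHS. -/
theorem abs_apply_le {C : ℝ} (hC : ∀ s, |k s s| ≤ C) (f : k.rkhs) (s : S) :
    |f s| ≤ ‖f‖ * √C := by
  have h := RKHS.norm_apply_le f s
  rw [RKHS.OfKernel.kernel_ofKernel, matrix_apply, norm_smul, ContinuousLinearMap.norm_id,
    mul_one, Real.norm_eq_abs, Real.norm_eq_abs] at h
  exact h.trans (by gcongr; exact hC s)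

/-- A jointly continuous kernel has a norm-continuous feature map into its RKHS. -/
theorem continuous_kerFun [TopologicalSpace S] (hk : Continuous fun p : S × S => k p.1 p.2)
    (v : ℝ) : Continuous fun s => RKHS.kerFun k.rkhs s v := by
  refine continuous_iff_continuousAt.2 fun t => tendsto_iff_norm_sub_tendsto_zero.2 ?_
  have hsq : ∀ s, ‖RKHS.kerFun k.rkhs s v - RKHS.kerFun k.rkhs t v‖ =
      √((k s s - 2 * k s t + k t t) * (v * v)) := fun s => by
    rw [← Real.sqrt_sq (norm_nonneg (_ - _)), norm_sub_sq_real, ← real_inner_self_eq_norm_sq,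
      ← real_inner_self_eq_norm_sq, inner_kerFun_kerFun, inner_kerFun_kerFun, inner_kerFun_kerFun]
    congr 1
    ring
  have h₁ : Continuous fun s => k s s := hk.comp (continuous_id.prodMk continuous_id)
  have h₂ : Continuous fun s => k s t := hk.comp (continuous_id.prodMk continuous_const)
  have hc : Continuous fun s => √((k s s - 2 * k s t + k t t) * (v * v)) := by fun_prop
  have ht := hc.tendsto t
  have h0 : k t t - 2 * k t t + k t t = 0 := by ring
  simp only [h0, zero_mul, Real.sqrt_zero] at ht
  simpa only [hsq] using ht

end RealKernel

/-! ### Approximation of probability measures by empirical measures -/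

section Empirical

variable {X : Type u} [MetricSpace X] [MeasurableSpace X] [BorelSpace X]

theorem integral_empirical {M : ℕ+} (x : Fin M → X) (f : X → ℝ) :
    ∫ a, f a ∂(empirical x : Measure X) = (∑ i, f (x i)) / (M : ℕ) := by
  change ∫ a, f a ∂(((M : ℕ) : ℝ≥0∞)⁻¹ • ∑ i, Measure.dirac (x i)) = _
  rw [integral_smul_measure, integral_finsetSum_measure fun i _ => integrable_dirac (by simp)]
  simp [div_eq_inv_mul]

variable [CompactSpace X]

/-- It suffices to test weak convergence on a dense set of continuous functions. -/
theorem tendsto_probabilityMeasure_of_dense {s : Set C(X, ℝ)} (hs : Dense s)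
    {ν : ℕ → ProbabilityMeasure X} {μ : ProbabilityMeasure X}
    (h : ∀ f ∈ s, Tendsto (fun n => ∫ a, f a ∂(ν n : Measure X)) atTop
      (𝓝 (∫ a, f a ∂(μ : Measure X)))) : Tendsto ν atTop (𝓝 μ) := by
  refine ProbabilityMeasure.tendsto_iff_forall_integral_tendsto.2 fun f => ?_
  rw [Metric.tendsto_atTop]
  intro ε hε
  obtain ⟨g, hgs, hg⟩ := Metric.dense_iff.1 hs f.toContinuousMap (ε / 3) (by positivity)
  have hclose : ∀ ρ : ProbabilityMeasure X,
      dist (∫ a, f a ∂(ρ : Measure X)) (∫ a, g a ∂(ρ : Measure X)) ≤ ε / 3 := fun ρ => by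
    have hgi : Integrable (fun a => g a) (ρ : Measure X) :=
      g.continuous.integrable_of_hasCompactSupport (HasCompactSupport.of_compactSpace _)
    rw [dist_eq_norm, ← integral_sub (f.integrable _) hgi]
    refine (norm_integral_le_of_norm_le_const (C := ε / 3) (.of_forall fun a => ?_)).trans ?_
    · rw [← dist_eq_norm]
      exact (ContinuousMap.dist_apply_le_dist (f := f.toContinuousMap) a).trans
        (by rw [dist_comm]; exact (Metric.mem_ball.1 hgs).le)
    · simp
  obtain ⟨N, hN⟩ := Metric.tendsto_atTop.1 (h g hg) (ε / 3) (by positivity)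
  refine ⟨N, fun n hn => ?_⟩
  have h₁ := hclose (ν n)
  have h₂ := hN n hn
  have h₃ := hclose μ
  rw [dist_comm] at h₃
  linarith [dist_triangle4 (∫ a, f a ∂(ν n : Measure X)) (∫ a, g a ∂(ν n : Measure X))
    (∫ a, g a ∂(μ : Measure X)) (∫ a, f a ∂(μ : Measure X))]

/-- Every probability measure on a compact metric space is the weak limit of the empirical measures
of a suitable sequence of points, along any sequence of sample sizes tending to infinity. -/
theorem exists_tendsto_empirical (μ : ProbabilityMeasure X) {m : ℕ → ℕ+} (hm : StrictMono m) :
    ∃ x : ℕ → X, Tendsto (fun l => empirical fun i : Fin (m l) => x i) atTop (𝓝 μ) := by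
  obtain ⟨Ω, _, P, Y, hYm, hlaw, hindep, _⟩ := ProbabilityTheory.exists_iid ℕ (μ : Measure X)
  have hslln : ∀ f : C(X, ℝ), ∀ᵐ ω ∂P, Tendsto
      (fun n : ℕ => (∑ i ∈ Finset.range n, f (Y i ω)) / n) atTop
      (𝓝 (∫ a, f a ∂(μ : Measure X))) := fun f => by
    have hint : Integrable (fun a => f a) (μ : Measure X) :=
      f.continuous.integrable_of_hasCompactSupport (HasCompactSupport.of_compactSpace _)
    have hid : ∀ i, ProbabilityTheory.IdentDistrib (fun ω => f (Y i ω)) (fun ω => f (Y 0 ω)) P P :=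
      fun i => ((hlaw i).identDistrib (hlaw 0)).comp f.continuous.measurable
    have h := ProbabilityTheory.strong_law_ae_real (μ := P) (fun i ω => f (Y i ω))
      (((hlaw 0).measurePreserving (hYm 0)).integrable_comp_of_integrable hint)
      (fun i j hij => (hindep.indepFun hij).comp f.continuous.measurable f.continuous.measurable)
      hid
    rwa [show ∫ ω, f (Y 0 ω) ∂P = ∫ a, f a ∂(μ : Measure X) from
      (hlaw 0).integral_comp f.continuous.aestronglyMeasurable] at h
  obtain ⟨s, hsc, hsd⟩ := TopologicalSpace.exists_countable_dense C(X, ℝ)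
  obtain ⟨ω, hω⟩ := ((ae_ball_iff hsc).2 fun f _ => hslln f).exists
  refine ⟨fun i => Y i ω, tendsto_probabilityMeasure_of_dense hsd fun f hf => ?_⟩
  have hm' : Tendsto (fun l => (m l : ℕ)) atTop atTop :=
    StrictMono.tendsto_atTop fun _ _ hab => hm hab
  refine ((hω f hf).comp hm').congr fun l => ?_
  rw [integral_empirical, Function.comp_apply, Finset.sum_range]

end Empirical

/-! ### Functions approximable by the kernels on tuples -/

section Approximable

variable {X : Type u} [MeasurableSpace X]

/-- A function on probability measures is approximable along `m` if, for all large `l`, its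
restriction to empirical measures of `m l` points is uniformly close to an element of the RKHS of
`k (m l)`. -/
def IsApproximable (k : (M : ℕ+) → RealKernel (Fin M → X)) (m : ℕ → ℕ+)
    (f : ProbabilityMeasure X → ℝ) : Prop :=
  ∀ ε > 0, ∀ᶠ l in atTop, ∃ g : (k (m l)).rkhs, ∀ x : Fin (m l) → X, |g x - f (empirical x)| ≤ ε

namespace IsApproximable

variable {k : (M : ℕ+) → RealKernel (Fin M → X)} {m : ℕ → ℕ+} {f f' : ProbabilityMeasure X → ℝ}

theorem zero : IsApproximable k m 0 := fun ε hε =>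
  .of_forall fun l => ⟨0, fun x => by simpa using hε.le⟩

theorem add (hf : IsApproximable k m f) (hf' : IsApproximable k m f') :
    IsApproximable k m (f + f') := fun ε hε => by
  filter_upwards [hf (ε / 2) (half_pos hε), hf' (ε / 2) (half_pos hε)] with l ⟨g, hg⟩ ⟨g', hg'⟩
  refine ⟨g + g', fun x => ?_⟩
  rw [RKHS.coe_add, Pi.add_apply, Pi.add_apply, add_sub_add_comm]
  linarith [abs_add_le (g x - f (empirical x)) (g' x - f' (empirical x)), hg x, hg' x]

theorem smul (c : ℝ) (hf : IsApproximable k m f) : IsApproximable k m (c • f) := fun ε hε => by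
  filter_upwards [hf (ε / (|c| + 1)) (by positivity)] with l ⟨g, hg⟩
  refine ⟨c • g, fun x => ?_⟩
  rw [RKHS.coe_smul, Pi.smul_apply, Pi.smul_apply, ← smul_sub, smul_eq_mul, abs_mul]
  calc |c| * |g x - f (empirical x)| ≤ (|c| + 1) * (ε / (|c| + 1)) := by
        gcongr
        · linarith
        · exact hg x
    _ = ε := by field_simp

theorem of_forall_exists_abs_sub_le
    (h : ∀ ε > 0, ∃ f', IsApproximable k m f' ∧ ∀ μ, |f' μ - f μ| ≤ ε) :
    IsApproximable k m f := fun ε hε => by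
  obtain ⟨f', hf', hff'⟩ := h (ε / 2) (half_pos hε)
  filter_upwards [hf' (ε / 2) (half_pos hε)] with l ⟨g, hg⟩
  refine ⟨g, fun x => ?_⟩
  linarith [abs_sub_le (g x) (f' (empirical x)) (f (empirical x)), hg x, hff' (empirical x)]

/-- Approximability yields a sequence of approximants, along a subsequence, with uniform error
tending to zero. -/
theorem exists_seq (hf : IsApproximable k m f) :
    ∃ (φ : ℕ → ℕ) (g : (l : ℕ) → (k (m (φ l))).rkhs), StrictMono φ ∧
      Tendsto (fun l => ⨆ x : Fin (m (φ l)) → X,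
        ENNReal.ofReal |g l x - f (empirical x)|) atTop (𝓝 0) := by
  obtain ⟨φ, hφ, h⟩ := extraction_forall_of_eventually fun n : ℕ =>
    hf (1 / ((n : ℝ) + 1)) Nat.one_div_pos_of_nat
  choose g hg using h
  refine ⟨φ, g, hφ, ?_⟩
  have hlim := ENNReal.tendsto_ofReal tendsto_one_div_add_atTop_nhds_zero_nat
  rw [ENNReal.ofReal_zero] at hlim
  exact tendsto_of_tendsto_of_tendsto_of_le_of_le tendsto_const_nhds hlim (fun _ => zero_le)
    fun l => iSup_le fun x => ENNReal.ofReal_le_ofReal (hg l x)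

end IsApproximable

variable [MetricSpace X] [CompactSpace X] [BorelSpace X]
  {k : (M : ℕ+) → RealKernel (Fin M → X)} {m : ℕ → ℕ+} {κ : RealKernel (ProbabilityMeasure X)}

/-- The approximants of the kernel function at `μ` are the kernel functions at tuples whose
empirical measures converge to `μ`. -/
theorem IsMeanFieldLimit.isApproximable_kerFun (hκ : IsMeanFieldLimit k m κ)
    (μ : ProbabilityMeasure X) (v : ℝ) : IsApproximable k m (RKHS.kerFun κ.rkhs μ v) := by
  intro ε hε
  obtain ⟨y, hy⟩ := exists_tendsto_empirical μ hκ.strictMono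
  obtain ⟨C, hC⟩ := hκ.bounded
  have hfun := (tendsto_iff_norm_sub_tendsto_zero.1
    ((κ.continuous_kerFun hκ.continuous v).tendsto μ |>.comp hy)).mul_const √C
  rw [zero_mul] at hfun
  have hδ : 0 < ε / (2 * (|v| + 1)) := by positivity
  filter_upwards [hfun.eventually (gt_mem_nhds (half_pos hε)),
    hκ.tendsto.eventually (gt_mem_nhds (ENNReal.ofReal_pos.2 hδ))] with l h₁ h₂
  set z : Fin (m l) → X := fun i => y i
  refine ⟨RKHS.kerFun (k (m l)).rkhs z v, fun x => ?_⟩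
  have hA : |κ (empirical x) (empirical z) * v - κ (empirical x) μ * v| ≤ ε / 2 := by
    have h := κ.abs_apply_le (fun ν => hC ν ν)
      (RKHS.kerFun κ.rkhs (empirical z) v - RKHS.kerFun κ.rkhs μ v) (empirical x)
    rw [RKHS.coe_sub, Pi.sub_apply, RealKernel.kerFun_apply, RealKernel.kerFun_apply] at h
    exact h.trans h₁.le
  have hB : |k (m l) x z * v - κ (empirical x) (empirical z) * v| ≤ ε / 2 := by
    have h := (le_iSup₂ (f := fun (x x' : Fin (m l) → X) =>
      ENNReal.ofReal |k (m l) x x' - κ (empirical x) (empirical x')|) x z).trans h₂.le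
    rw [ENNReal.ofReal_le_ofReal_iff hδ.le] at h
    rw [← sub_mul, abs_mul]
    calc _ ≤ ε / (2 * (|v| + 1)) * (|v| + 1) := by
          gcongr
          linarith
      _ = ε / 2 := by field_simp
  rw [RealKernel.kerFun_apply, RealKernel.kerFun_apply]
  linarith [abs_sub_le (k (m l) x z * v) (κ (empirical x) (empirical z) * v)
    (κ (empirical x) μ * v)]

theorem IsMeanFieldLimit.isApproximable (hκ : IsMeanFieldLimit k m κ) (f : κ.rkhs) :
    IsApproximable k m f := by
  obtain ⟨C, hC⟩ := hκ.bounded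
  have hspan : ∀ h ∈ Submodule.span ℝ {RKHS.kerFun κ.rkhs μ v | (μ) (v)},
      IsApproximable k m h := fun h hh => by
    induction hh using Submodule.span_induction with
    | mem h hh =>
      obtain ⟨μ, v, rfl⟩ := hh
      exact hκ.isApproximable_kerFun μ v
    | zero => rw [RKHS.coe_zero]; exact .zero
    | add _ _ _ _ h₁ h₂ => rw [RKHS.coe_add]; exact h₁.add h₂
    | smul c _ _ h => rw [RKHS.coe_smul]; exact h.smul c
  refine .of_forall_exists_abs_sub_le fun ε hε => ?_
  have hf : f ∈ closure (Submodule.span ℝ {RKHS.kerFun κ.rkhs μ v | (μ) (v)} : Set κ.rkhs) := by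
    rw [← Submodule.topologicalClosure_coe, RKHS.kerFun_dense]
    trivial
  obtain ⟨h, hh, hd⟩ := Metric.mem_closure_iff.1 hf (ε / (√C + 1)) (by positivity)
  refine ⟨h, hspan h hh, fun μ => ?_⟩
  rw [← Pi.sub_apply, ← RKHS.coe_sub]
  rw [dist_comm, dist_eq_norm] at hd
  calc _ ≤ ‖h - f‖ * √C := κ.abs_apply_le (fun ν => hC ν ν) (h - f) μ
    _ ≤ ε / (√C + 1) * (√C + 1) := by
        gcongr
        linarith
    _ = ε := by field_simp

end Approximable

end MeanField

theorem theorem4p4 {X : Type u} [MetricSpace X] [CompactSpace X] [MeasurableSpace X] [BorelSpace X]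
    (k : (M : ℕ+) → MeanField.RealKernel (Fin M → X)) (hk : MeanField.MeanFieldConditions k)
    (m : ℕ → ℕ+) (κ : MeanField.RealKernel (ProbabilityMeasure X))
    (hκ : MeanField.IsMeanFieldLimit k m κ) (f : κ.rkhs) :
    ∃ (φ : ℕ → ℕ) (g : (l : ℕ) → (k (m (φ l))).rkhs), StrictMono φ ∧
      Tendsto (fun l => ⨆ x : Fin (m (φ l)) → X,
        ENNReal.ofReal |g l x - f (MeanField.empirical x)|) atTop (𝓝 0) :=
  (hκ.isApproximable f).exists_seq
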